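/- **Definitions.** A *commutativity condition* in a graph $\mathcal G$ is a pair of parallel paths (possibly of length $0$). A *finite limit* (resp. *colimit*) *condition* in $\mathcal G$ is given by a finite graph $\mathcal H$, a graph morphism $D\colon\mathcal H\to\mathcal G$, a vertex $C$ of $\mathcal G$ and, for every vertex $H$ of $\mathcal H$, an arrow $c_H\colon C\to D(H)$ (resp. $c_H\colon D(H)\to C$), up to isomorphism of $\mathcal H$ compatible with $D$ and the $c_H$. A *sketch* is a finite graph with a set of commutativity conditions, a set of finite limit conditions and a set of finite colimit conditions. A *subsketch inclusion* is an inclusion of underlying graphs carrying conditions to conditions. For a sketch $\mathcal Z$ and a category $\mathbb C$, a *$\mathcal Z$-structure in $\mathbb C$* is a graph morphism $\mathcal Z\to\mathbb C$ carrying the conditions of $\mathcal Z$ to commutative diagrams, limit cones and colimit cocones in $\mathbb C$; with natural transformations as morphisms these form a category $\mathcal Z\mathbb C$. Composition with a subsketch inclusion $\beta\colon\mathcal A\to\mathcal B$ gives a functor $\beta_{\mathbb C}\colon\mathcal B\mathbb C\to\mathcal A\mathbb C$. An *$\varnothing$-sequent* $\alpha\vdash\beta$ is a sequence of subsketch inclusions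 $\varnothing\xrightarrow{\alpha}\mathcal A\xrightarrow{\beta}\mathcal B$ starting with the empty sketch. A *functorial verification* of it for $\mathbb C$ is a functor $E\colon\mathcal A\mathbb C\to\mathcal B\mathbb C$ with $\beta_{\mathbb C}\circ E=1_{\mathcal A\mathbb C}$ (strict equality). The inclusion $\alpha\colon\varnothing\to\mathcal A$ is *unconditional of finite kind* if $\mathcal A$ is the underlying sketch of a finite category $\mathbb A$: its graph is the underlying graph of $\mathbb A$, its commutativity conditions are exactly $((A,f,B,g,C),(A,gf,C))$ for composable arrows $f\colon A\to B$, $g\colon B\to C$ of $\mathbb A$ and $((A,1_A,A),(A))$ for objects $A$ of $\mathbb A$, and it has no limit or colimit conditions. **Corollary 2.3.** Let $\alpha\vdash\beta$ be an $\varnothing$-sequent with $\alpha$ unconditional of finite kind, and let $\mathbb C$ be a small category with finite limits. If there is a functorial verification of $\alpha\vdash\beta$ for $\mathbb C$, then there is a functorial verification of $\alpha\vdash\beta$ for $\mathrm{Lex}(\mathbb C,\mathbf{Set})^{\mathrm{op}}$, the opposite of the category of finite limit preserving functors $\mathbb C\to\mathbf{Set}$ and natural transformations. -/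

import Mathlib

open CategoryTheory CategoryTheory.Limits

universe v u

/-- A commutativity condition in a graph: a pair of parallel paths. -/
structure CommCondition (V : Type) [Quiver.{0} V] where
  src : V
  tgt : V
  left : Quiver.Path src tgt
  right : Quiver.Path src tgt

namespace CommCondition

variable {V W : Type} [Quiver.{0} V] [Quiver.{0} W]

/-- The image of a commutativity condition under a morphism of graphs. -/
def map (φ : V ⥤q W) (c : CommCondition V) : CommCondition W where
  src := φ.obj c.src
  tgt := φ.obj c.tgt
  left := φ.mapPath c.left
  right := φ.mapPath c.right

/-- The graph morphism `F` into (the underlying graph of) a category carries the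
commutativity condition `c` to an actual commutative diagram. -/
def Holds {C : Type u} [Category.{v} C] (c : CommCondition V) (F : V ⥤q C) : Prop :=
  composePath (F.mapPath c.left) = composePath (F.mapPath c.right)

end CommCondition

/-- A finite diagram `D : H ⥤q V` in the graph `V`: a finite graph `H` (finitely many vertices
and arrows) with a morphism of graphs to `V`. Finite sets are taken in `Type`. -/
structure FiniteDiagram (V : Type) [Quiver.{0} V] where
  H : Type
  [quiver : Quiver.{0} H]
  [finite_obj : Finite H]
  [finite_hom : ∀ a b : H, Finite (a ⟶ b)]
  D : H ⥤q V

attribute [instance] FiniteDiagram.quiver FiniteDiagram.finite_obj FiniteDiagram.finite_hom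

namespace FiniteDiagram

variable {V W : Type} [Quiver.{0} V] [Quiver.{0} W]

/-- The image of a finite diagram under a morphism of graphs. -/
def map (φ : V ⥤q W) (d : FiniteDiagram V) : FiniteDiagram W where
  H := d.H
  D := d.D ⋙q φ

/-- An isomorphism of the indexing graphs of two finite diagrams in `V`, over `V`. -/
structure Iso (d e : FiniteDiagram V) where
  hom : d.H ⥤q e.H
  inv : e.H ⥤q d.H
  hom_inv : hom ⋙q inv = 𝟭q d.H
  inv_hom : inv ⋙q hom = 𝟭q e.H
  comm : hom ⋙q e.D = d.D

/-- The identity isomorphism. -/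
def Iso.refl (d : FiniteDiagram V) : Iso d d where
  hom := 𝟭q d.H
  inv := 𝟭q d.H
  hom_inv := rfl
  inv_hom := rfl
  comm := rfl

/-- The inverse isomorphism. -/
def Iso.symm {d e : FiniteDiagram V} (i : Iso d e) : Iso e d where
  hom := i.inv
  inv := i.hom
  hom_inv := i.inv_hom
  inv_hom := i.hom_inv
  comm := by
    rw [← i.comm, ← Prefunctor.comp_assoc, i.inv_hom, Prefunctor.id_comp]

/-- The composite isomorphism. -/
def Iso.trans {d e f : FiniteDiagram V} (i : Iso d e) (j : Iso e f) : Iso d f where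
  hom := i.hom ⋙q j.hom
  inv := j.inv ⋙q i.inv
  hom_inv := by
    have h : (i.hom ⋙q j.hom) ⋙q (j.inv ⋙q i.inv)
        = i.hom ⋙q ((j.hom ⋙q j.inv) ⋙q i.inv) := rfl
    rw [h, j.hom_inv, Prefunctor.id_comp, i.hom_inv]
  inv_hom := by
    have h : (j.inv ⋙q i.inv) ⋙q (i.hom ⋙q j.hom)
        = j.inv ⋙q ((i.inv ⋙q i.hom) ⋙q j.hom) := rfl
    rw [h, i.inv_hom, Prefunctor.id_comp, j.inv_hom]
  comm := by
    rw [Prefunctor.comp_assoc, j.comm, i.comm]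

end FiniteDiagram

section GraphCones

variable {H : Type} [Quiver.{0} H] {C : Type u} [Category.{v} C]

/-- A cone over a graph-indexed diagram in a category, as a cone over the induced functor on the
free category on the graph. -/
def graphCone (K : H ⥤q C) (X : C) (c : ∀ h : H, X ⟶ K.obj h)
    (w : ∀ ⦃a b : H⦄ (f : a ⟶ b), c a ≫ K.map f = c b) : Cone (Paths.lift K) where
  pt := X
  π := Paths.liftNatTrans (F := (Functor.const (Paths H)).obj X) (G := Paths.lift K)
    c (fun {a b} f => by
      have h1 : (Paths.lift K).map f.toPath = K.map f := Paths.lift_toPath K f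
      have h2 : c b = c a ≫ (Paths.lift K).map f.toPath := by rw [h1]; exact (w f).symm
      exact (Category.id_comp _).trans h2)

/-- A cocone under a graph-indexed diagram in a category, as a cocone under the induced functor
on the free category on the graph. -/
def graphCocone (K : H ⥤q C) (X : C) (c : ∀ h : H, K.obj h ⟶ X)
    (w : ∀ ⦃a b : H⦄ (f : a ⟶ b), K.map f ≫ c b = c a) : Cocone (Paths.lift K) where
  pt := X
  ι := Paths.liftNatTrans (F := Paths.lift K) (G := (Functor.const (Paths H)).obj X)
    c (fun {a b} f => by
      have h1 : (Paths.lift K).map f.toPath = K.map f := Paths.lift_toPath K f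
      have h2 : (Paths.lift K).map f.toPath ≫ c b = c a := by rw [h1]; exact w f
      exact h2.trans (Category.comp_id _).symm)

end GraphCones

/-- A representative `(H, D, C, (c_h))` of a finite limit condition in a graph:
`D : H ⥤q V` is a finite diagram and `c_h : C ⟶ D h` for each vertex `h` of `H`. -/
structure LimitDatum (V : Type) [Quiver.{0} V] extends FiniteDiagram V where
  apex : V
  leg : ∀ h : H, apex ⟶ D.obj h

/-- A representative `(H, D, C, (c_h))` of a finite colimit condition in a graph:
`D : H ⥤q V` is a finite diagram and `c_h : D h ⟶ C` for each vertex `h` of `H`. -/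
structure ColimitDatum (V : Type) [Quiver.{0} V] extends FiniteDiagram V where
  apex : V
  leg : ∀ h : H, D.obj h ⟶ apex

namespace LimitDatum

variable {V W : Type} [Quiver.{0} V] [Quiver.{0} W]

/-- Two representatives are equivalent when they have the same apex and their indexing graphs are
isomorphic, compatibly with the diagrams and the legs. -/
instance setoid (V : Type) [Quiver.{0} V] : Setoid (LimitDatum V) where
  r s t := s.apex = t.apex ∧
    ∃ i : FiniteDiagram.Iso s.toFiniteDiagram t.toFiniteDiagram,
      ∀ h, HEq (s.leg h) (t.leg (i.hom.obj h))
  iseqv :=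
    { refl := fun s => ⟨rfl, .refl _, fun _ => HEq.rfl⟩
      symm := by
        rintro s t ⟨h, i, hi⟩
        refine ⟨h.symm, i.symm, fun k => ?_⟩
        have e : i.hom.obj (i.inv.obj k) = k := Prefunctor.congr_obj i.inv_hom k
        have := (hi (i.inv.obj k)).symm
        rw [e] at this
        exact this
      trans := by
        rintro r s t ⟨h, i, hi⟩ ⟨h', j, hj⟩
        exact ⟨h.trans h', i.trans j, fun k => (hi k).trans (hj (i.hom.obj k))⟩ }

/-- The image of a representative under a morphism of graphs. -/
def map (φ : V ⥤q W) (t : LimitDatum V) : LimitDatum W where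
  toFiniteDiagram := t.toFiniteDiagram.map φ
  apex := φ.obj t.apex
  leg h := φ.map (t.leg h)

/-- The graph morphism `F` into a category `C` carries `t` to an actual limit cone in `C`. -/
def Holds {C : Type u} [Category.{v} C] (t : LimitDatum V) (F : V ⥤q C) : Prop :=
  ∃ w : ∀ ⦃a b : t.H⦄ (f : a ⟶ b), F.map (t.leg a) ≫ F.map (t.D.map f) = F.map (t.leg b),
    Nonempty (IsLimit (graphCone (t.D ⋙q F) (F.obj t.apex) (fun h => F.map (t.leg h)) w))

end LimitDatum

namespace ColimitDatum

variable {V W : Type} [Quiver.{0} V] [Quiver.{0} W]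

/-- Two representatives are equivalent when they have the same apex and their indexing graphs are
isomorphic, compatibly with the diagrams and the legs. -/
instance setoid (V : Type) [Quiver.{0} V] : Setoid (ColimitDatum V) where
  r s t := s.apex = t.apex ∧
    ∃ i : FiniteDiagram.Iso s.toFiniteDiagram t.toFiniteDiagram,
      ∀ h, HEq (s.leg h) (t.leg (i.hom.obj h))
  iseqv :=
    { refl := fun s => ⟨rfl, .refl _, fun _ => HEq.rfl⟩
      symm := by
        rintro s t ⟨h, i, hi⟩
        refine ⟨h.symm, i.symm, fun k => ?_⟩
        have e : i.hom.obj (i.inv.obj k) = k := Prefunctor.congr_obj i.inv_hom k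
        have := (hi (i.inv.obj k)).symm
        rw [e] at this
        exact this
      trans := by
        rintro r s t ⟨h, i, hi⟩ ⟨h', j, hj⟩
        exact ⟨h.trans h', i.trans j, fun k => (hi k).trans (hj (i.hom.obj k))⟩ }

/-- The image of a representative under a morphism of graphs. -/
def map (φ : V ⥤q W) (t : ColimitDatum V) : ColimitDatum W where
  toFiniteDiagram := t.toFiniteDiagram.map φ
  apex := φ.obj t.apex
  leg h := φ.map (t.leg h)

/-- The graph morphism `F` into a category `C` carries `t` to an actual colimit cocone in `C`. -/
def Holds {C : Type u} [Category.{v} C] (t : ColimitDatum V) (F : V ⥤q C) : Prop :=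
  ∃ w : ∀ ⦃a b : t.H⦄ (f : a ⟶ b), F.map (t.D.map f) ≫ F.map (t.leg b) = F.map (t.leg a),
    Nonempty (IsColimit (graphCocone (t.D ⋙q F) (F.obj t.apex) (fun h => F.map (t.leg h)) w))

end ColimitDatum

/-- A finite limit condition: an equivalence class of representatives. -/
abbrev LimitCondition (V : Type) [Quiver.{0} V] := Quotient (LimitDatum.setoid V)

/-- A finite colimit condition: an equivalence class of representatives. -/
abbrev ColimitCondition (V : Type) [Quiver.{0} V] := Quotient (ColimitDatum.setoid V)

/-- An exactness sketch: a finite graph with a set of commutativity conditions and a set of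
convergence conditions (finite limit conditions and finite colimit conditions). -/
structure Sketch where
  V : Type
  [quiver : Quiver.{0} V]
  [finite_obj : Finite V]
  [finite_hom : ∀ a b : V, Finite (a ⟶ b)]
  comm : Set (CommCondition V)
  lim : Set (LimitCondition V)
  colim : Set (ColimitCondition V)

attribute [instance] Sketch.quiver Sketch.finite_obj Sketch.finite_hom

namespace Sketch

/-- A morphism of sketches: a morphism of the underlying graphs which carries each condition to
a condition. -/
structure Hom (A B : Sketch) where
  graph : A.V ⥤q B.V
  comm : ∀ c ∈ A.comm, c.map graph ∈ B.comm
  lim : ∀ t : LimitDatum A.V, (⟦t⟧ : LimitCondition A.V) ∈ A.lim →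
    (⟦t.map graph⟧ : LimitCondition B.V) ∈ B.lim
  colim : ∀ t : ColimitDatum A.V, (⟦t⟧ : ColimitCondition A.V) ∈ A.colim →
    (⟦t.map graph⟧ : ColimitCondition B.V) ∈ B.colim

/-- Composition of morphisms of sketches. -/
def Hom.comp {A B D : Sketch} (φ : Hom A B) (ψ : Hom B D) : Hom A D where
  graph := φ.graph ⋙q ψ.graph
  comm c hc := by
    have h := ψ.comm _ (φ.comm c hc)
    have e : c.map (φ.graph ⋙q ψ.graph) = (c.map φ.graph).map ψ.graph := by
      simp only [CommCondition.map, Prefunctor.mapPath_comp_apply]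
      rfl
    rw [e]
    exact h
  lim t ht := ψ.lim _ (φ.lim t ht)
  colim t ht := ψ.colim _ (φ.colim t ht)

/-- A subsketch inclusion: a morphism of sketches which is injective on vertices and on arrows,
so that it identifies its domain with a sketch structure on a subgraph of the codomain. -/
def Hom.IsInclusion {A B : Sketch} (φ : Hom A B) : Prop :=
  Function.Injective φ.graph.obj ∧
    ∀ a b : A.V, Function.Injective (fun f : a ⟶ b => φ.graph.map f)

/-- The empty sketch. -/
def empty : Sketch :=
  letI : Quiver.{0} Empty := ⟨fun _ _ => Empty⟩
  { V := Empty
    finite_hom := fun a => a.elim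
    comm := ∅
    lim := ∅
    colim := ∅ }

/-- A structure of type `S` in the category `C`: a morphism of graphs from `S` to `C` which
carries each condition of `S` to an actual commutative diagram, limit, or colimit in `C`. -/
structure Structure (S : Sketch) (C : Type u) [Category.{v} C] where
  graph : S.V ⥤q C
  comm : ∀ c ∈ S.comm, c.Holds graph
  lim : ∀ t : LimitDatum S.V, (⟦t⟧ : LimitCondition S.V) ∈ S.lim → t.Holds graph
  colim : ∀ t : ColimitDatum S.V, (⟦t⟧ : ColimitCondition S.V) ∈ S.colim → t.Holds graph

namespace Structure

variable {S : Sketch} {C : Type u} [Category.{v} C]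

/-- A natural transformation between structures. -/
@[ext]
structure Hom (F G : Structure S C) where
  app : ∀ a : S.V, F.graph.obj a ⟶ G.graph.obj a
  naturality : ∀ ⦃a b : S.V⦄ (f : a ⟶ b), F.graph.map f ≫ app b = app a ≫ G.graph.map f

/-- Structures of type `S` in `C` and natural transformations form a category. -/
instance category : Category (Structure S C) where
  Hom := Hom
  id F := { app := fun a => 𝟙 (F.graph.obj a), naturality := fun a b f => by simp }
  comp α β :=
    { app := fun a => α.app a ≫ β.app a
      naturality := fun a b f => by
        rw [← Category.assoc, α.naturality, Category.assoc, β.naturality, Category.assoc] }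
  id_comp α := Hom.ext (funext fun a => Category.id_comp _)
  comp_id α := Hom.ext (funext fun a => Category.comp_id _)
  assoc α β γ := Hom.ext (funext fun a => Category.assoc _ _ _)

end Structure

/-- The functor `φ_C` of composition with a morphism of sketches `φ : A ⟶ B`, from structures of
type `B` in `C` to structures of type `A` in `C`. -/
def Hom.restrict {A B : Sketch} (φ : Hom A B) (C : Type u) [Category.{v} C] :
    Structure B C ⥤ Structure A C where
  obj F :=
    { graph := φ.graph ⋙q F.graph
      comm := fun c hc => by
        have h := F.comm _ (φ.comm c hc)
        simp only [CommCondition.Holds, Prefunctor.mapPath_comp_apply]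
        exact h
      lim := fun t ht => F.lim _ (φ.lim t ht)
      colim := fun t ht => F.colim _ (φ.colim t ht) }
  map m :=
    { app := fun a => m.app (φ.graph.obj a)
      naturality := fun _ _ f => m.naturality (φ.graph.map f) }

/-- The unique structure of type the empty sketch in a category. -/
def emptyStructure (C : Type u) [Category.{v} C] : Structure empty C where
  graph := { obj := fun a : Empty => a.elim, map := fun {a : Empty} _ _ => a.elim }
  comm := fun _ h => h.elim
  lim := fun _ h => h.elim
  colim := fun _ h => h.elim

/-- The structure of a category on a graph, i.e. identities and a composition of arrows subject
to the laws of a category. -/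
structure CategoryOn (V : Type) [Quiver.{0} V] where
  id : ∀ a : V, a ⟶ a
  comp : ∀ {a b c : V}, (a ⟶ b) → (b ⟶ c) → (a ⟶ c)
  id_comp : ∀ {a b : V} (f : a ⟶ b), comp (id a) f = f
  comp_id : ∀ {a b : V} (f : a ⟶ b), comp f (id b) = f
  assoc : ∀ {a b c d : V} (f : a ⟶ b) (g : b ⟶ c) (h : c ⟶ d),
    comp (comp f g) h = comp f (comp g h)

/-- The commutativity conditions of the underlying sketch of a (finite) category: for each
composable pair `(f, g)`, the path `f, g` equals the path consisting of the composite arrow; and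
for each object, the path consisting of the identity arrow equals the empty path. -/
def CategoryOn.comms {V : Type} [Quiver.{0} V] (K : CategoryOn V) : Set (CommCondition V) :=
  {x | ∃ (a b c : V) (f : a ⟶ b) (g : b ⟶ c),
      x = ⟨a, c, f.toPath.cons g, (K.comp f g).toPath⟩} ∪
  {x | ∃ a : V, x = ⟨a, a, (K.id a).toPath, Quiver.Path.nil⟩}

/-- A subsketch inclusion `α : X ⟶ A` is unconditional of finite kind if `A` is the underlying
sketch of a finite category, further equipped with the commutativity and convergence conditions
which already appear in `X`, and no others. -/
def Hom.IsUnconditionalOfFiniteKind {X A : Sketch} (α : Hom X A) : Prop :=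
  α.IsInclusion ∧ ∃ K : CategoryOn A.V,
    A.comm = K.comms ∪ {c | ∃ x ∈ X.comm, c = x.map α.graph} ∧
    A.lim = {q | ∃ t : LimitDatum X.V, (⟦t⟧ : LimitCondition X.V) ∈ X.lim ∧
      q = ⟦t.map α.graph⟧} ∧
    A.colim = {q | ∃ t : ColimitDatum X.V, (⟦t⟧ : ColimitCondition X.V) ∈ X.colim ∧
      q = ⟦t.map α.graph⟧}

/-- An exactness sequent of type `X`, or `X`-sequent: a sequence `X ⟶ A ⟶ B` of subsketch
inclusions. -/
structure Sequent (X : Sketch) where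
  A : Sketch
  B : Sketch
  α : Hom X A
  β : Hom A B
  isInclusion_α : α.IsInclusion
  isInclusion_β : β.IsInclusion

namespace Sequent

variable {X : Sketch} (s : Sequent X) {C : Type u} [Category.{v} C] (F : Structure X C)

/-- The category of extensions of `F` along `α`: the fibre at `F` of the functor from structures
of type `A` to structures of type `X`. -/
abbrev FibreA := (s.α.restrict C).Fiber F

/-- The category of extensions of `F` along the composite of `α` and `β`: the fibre at `F` of the
functor from structures of type `B` to structures of type `X`. -/
abbrev FibreB := ((s.α.comp s.β).restrict C).Fiber F

/-- The restriction of the functor of composition with `β` to the fibres at `F`. -/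
def restrictFibre : s.FibreB F ⥤ s.FibreA F :=
  Functor.Fiber.inducedFunctor
    (F := (Functor.Fiber.fiberInclusion : s.FibreB F ⥤ _) ⋙ s.β.restrict C)
    (Functor.Fiber.fiberInclusion_comp_eq_const (p := (s.α.comp s.β).restrict C) (S := F))

/-- A functorial verification of the sequent for the structure `F`: a functor which is (strictly)
right inverse to the functor of restriction along `β` between the fibres at `F`. -/
structure FunctorialVerification where
  toFunctor : s.FibreA F ⥤ s.FibreB F
  comp_eq : toFunctor ⋙ s.restrictFibre F = 𝟭 (s.FibreA F)

end Sequent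

/-- The sequent of type the empty sketch admits a functorial verification for the category `C`,
that is, for the unique structure of type the empty sketch in `C`. -/
def Sequent.HoldsFunctorially (s : Sequent Sketch.empty) (C : Type u) [Category.{v} C] : Prop :=
  Nonempty (s.FunctorialVerification (emptyStructure C))

end Sketch

/-- The pro-completion of a small finitely complete category `C`: the opposite of the category of
finite limit preserving functors from `C` to sets. -/
abbrev ProCompletion (C : Type u) [SmallCategory C] := (C ⥤ₗ Type u)ᵒᵖ

/-! Since `s.α` is unconditional of finite kind, structures of type `s.A` are functors out of a
finite category 𝔸. Write y for the embedding of ℂ in its pro-completion. Every functor X from 𝔸 to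
the pro-completion is the pointwise limit of the functors G : 𝔸 → ℂ equipped with a map X → yG
(`isIso_toExtension`). The index category of this limit is cofiltered, because composition with y
preserves finite limits.

A verification E over ℂ therefore extends by E'(X) = lim E(G), computed vertex by vertex over the
same index category. Cofiltered limits of objects of ℂ, taken in the pro-completion, preserve
levelwise finite limits (`isGraphLimit_limFunctor`) and levelwise finite colimits
(`isGraphColimit_limFunctor`), so E'(X) is again a structure of type `s.B` (`extensionStructure`).
As E(G) restricts to G, the restriction of E'(X) is lim G, which is isomorphic to X, naturally in X.

This gives a section of restriction only up to isomorphism. As the inclusion is injective on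
vertices, the objects of E'(X) at vertices of `s.A` can be replaced by those of X, which makes the
section strict (`exists_comp_restrict_eq_id`). -/

open Opposite

universe w

/-! ### Limits and colimits of graph-indexed diagrams in elementary form -/

/-- The family `c` exhibits `X` as a limit of the graph-indexed diagram `K`. -/
structure IsGraphLimit {H : Type w} [Quiver.{w} H] {C : Type u} [Category.{v} C] (K : H ⥤q C)
    (X : C) (c : ∀ h : H, X ⟶ K.obj h) : Prop where
  w : ∀ ⦃a b : H⦄ (f : a ⟶ b), c a ≫ K.map f = c b
  existsUnique_lift : ∀ (Y : C) (s : ∀ h : H, Y ⟶ K.obj h),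
    (∀ ⦃a b : H⦄ (f : a ⟶ b), s a ≫ K.map f = s b) → ∃! l : Y ⟶ X, ∀ h, l ≫ c h = s h

/-- The family `c` exhibits `X` as a colimit of the graph-indexed diagram `K`. -/
structure IsGraphColimit {H : Type w} [Quiver.{w} H] {C : Type u} [Category.{v} C] (K : H ⥤q C)
    (X : C) (c : ∀ h : H, K.obj h ⟶ X) : Prop where
  w : ∀ ⦃a b : H⦄ (f : a ⟶ b), K.map f ≫ c b = c a
  existsUnique_desc : ∀ (Y : C) (s : ∀ h : H, K.obj h ⟶ Y),
    (∀ ⦃a b : H⦄ (f : a ⟶ b), K.map f ≫ s b = s a) → ∃! l : X ⟶ Y, ∀ h, c h ≫ l = s h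

section GraphCones

variable {H : Type} [Quiver.{0} H] {C : Type u} [Category.{v} C]

/-- Compatibility of a cone with all paths follows from compatibility with single arrows, so the
universal property can be stated without the free category. -/
theorem nonempty_isLimit_graphCone_iff (K : H ⥤q C) (X : C) (c : ∀ h : H, X ⟶ K.obj h)
    (w : ∀ ⦃a b : H⦄ (f : a ⟶ b), c a ≫ K.map f = c b) :
    Nonempty (IsLimit (graphCone K X c w)) ↔ IsGraphLimit K X c := by
  constructor
  · rintro ⟨hl⟩
    refine ⟨w, fun Y s hs => ⟨hl.lift (graphCone K Y s hs), fun h => hl.fac _ h, fun m hm => ?_⟩⟩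
    exact hl.uniq (graphCone K Y s hs) m hm
  · intro hK
    have key (s : Cone (Paths.lift K)) : ∃! l : s.pt ⟶ X, ∀ h, l ≫ c h = s.π.app h :=
      hK.existsUnique_lift s.pt (fun h => s.π.app h) fun a b f => by
        have h1 : (Paths.lift K).map f.toPath = K.map f := Paths.lift_toPath K f
        rw [← h1]
        exact s.w f.toPath
    choose l hl hu using key
    exact ⟨{ lift := l, fac := fun s h => hl s h, uniq := fun s m hm => hu s m hm }⟩

theorem nonempty_isColimit_graphCocone_iff (K : H ⥤q C) (X : C) (c : ∀ h : H, K.obj h ⟶ X)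
    (w : ∀ ⦃a b : H⦄ (f : a ⟶ b), K.map f ≫ c b = c a) :
    Nonempty (IsColimit (graphCocone K X c w)) ↔ IsGraphColimit K X c := by
  constructor
  · rintro ⟨hl⟩
    refine ⟨w, fun Y s hs => ⟨hl.desc (graphCocone K Y s hs), fun h => hl.fac _ h, fun m hm => ?_⟩⟩
    exact hl.uniq (graphCocone K Y s hs) m hm
  · intro hK
    have key (s : Cocone (Paths.lift K)) : ∃! l : X ⟶ s.pt, ∀ h, c h ≫ l = s.ι.app h :=
      hK.existsUnique_desc s.pt (fun h => s.ι.app h) fun a b f => by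
        have h1 : (Paths.lift K).map f.toPath = K.map f := Paths.lift_toPath K f
        rw [← h1]
        exact s.w f.toPath
    choose l hl hu using key
    exact ⟨{ desc := l, fac := fun s h => hl s h, uniq := fun s m hm => hu s m hm }⟩

end GraphCones

theorem LimitDatum.holds_iff {V : Type} [Quiver.{0} V] {C : Type u} [Category.{v} C]
    (t : LimitDatum V) (F : V ⥤q C) :
    t.Holds F ↔ IsGraphLimit (t.D ⋙q F) (F.obj t.apex) (fun h => F.map (t.leg h)) :=
  ⟨fun ⟨w, h⟩ => (nonempty_isLimit_graphCone_iff _ _ _ w).1 h,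
    fun h => ⟨h.w, (nonempty_isLimit_graphCone_iff _ _ _ h.w).2 h⟩⟩

theorem ColimitDatum.holds_iff {V : Type} [Quiver.{0} V] {C : Type u} [Category.{v} C]
    (t : ColimitDatum V) (F : V ⥤q C) :
    t.Holds F ↔ IsGraphColimit (t.D ⋙q F) (F.obj t.apex) (fun h => F.map (t.leg h)) :=
  ⟨fun ⟨w, h⟩ => (nonempty_isColimit_graphCocone_iff _ _ _ w).1 h,
    fun h => ⟨h.w, (nonempty_isColimit_graphCocone_iff _ _ _ h.w).2 h⟩⟩

section Isomorphisms

variable {H : Type w} [Quiver.{w} H] {C : Type u} [Category.{v} C] {K K' : H ⥤q C} {X X' : C}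

theorem IsGraphLimit.of_iso {c : ∀ h : H, X ⟶ K.obj h} (hc : IsGraphLimit K X c)
    (c' : ∀ h : H, X' ⟶ K'.obj h) (e : X ≅ X') (i : ∀ h, K.obj h ≅ K'.obj h)
    (hK : ∀ ⦃a b : H⦄ (f : a ⟶ b), K.map f ≫ (i b).hom = (i a).hom ≫ K'.map f)
    (hi : ∀ h, c h ≫ (i h).hom = e.hom ≫ c' h) : IsGraphLimit K' X' c' := by
  have hK' : ∀ ⦃a b : H⦄ (f : a ⟶ b), K'.map f ≫ (i b).inv = (i a).inv ≫ K.map f := by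
    intro a b f
    rw [Iso.comp_inv_eq, Category.assoc, hK, Iso.inv_hom_id_assoc]
  have hi' : ∀ h, c' h = e.inv ≫ c h ≫ (i h).hom := fun h => by
    rw [hi, Iso.inv_hom_id_assoc]
  constructor
  · intro a b f
    simp [hi', ← hK, reassoc_of% (hc.w f)]
  · intro Y s hs
    obtain ⟨l, hl, hu⟩ := hc.existsUnique_lift Y (fun h => s h ≫ (i h).inv) fun a b f => by
      rw [Category.assoc, ← hK', reassoc_of% (hs f)]
    refine ⟨l ≫ e.hom, fun h => ?_, fun m hm => ?_⟩
    · simp [hi', reassoc_of% (hl h)]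
    · rw [← hu (m ≫ e.inv) fun h => ?_]
      · simp
      · simp only [← hm h, hi', Category.assoc, Iso.hom_inv_id, Category.comp_id]

theorem IsGraphColimit.of_iso {c : ∀ h : H, K.obj h ⟶ X} (hc : IsGraphColimit K X c)
    (c' : ∀ h : H, K'.obj h ⟶ X') (e : X ≅ X') (i : ∀ h, K.obj h ≅ K'.obj h)
    (hK : ∀ ⦃a b : H⦄ (f : a ⟶ b), K.map f ≫ (i b).hom = (i a).hom ≫ K'.map f)
    (hi : ∀ h, c h ≫ e.hom = (i h).hom ≫ c' h) : IsGraphColimit K' X' c' := by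
  have hK' : ∀ ⦃a b : H⦄ (f : a ⟶ b), K'.map f ≫ (i b).inv = (i a).inv ≫ K.map f := by
    intro a b f
    rw [Iso.comp_inv_eq, Category.assoc, hK, Iso.inv_hom_id_assoc]
  have hi' : ∀ h, c' h = (i h).inv ≫ c h ≫ e.hom := fun h => by
    rw [hi, Iso.inv_hom_id_assoc]
  constructor
  · intro a b f
    simp only [hi', reassoc_of% (hK' f), reassoc_of% (hc.w f)]
  · intro Y s hs
    obtain ⟨l, hl, hu⟩ := hc.existsUnique_desc Y (fun h => (i h).hom ≫ s h) fun a b f => by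
      rw [reassoc_of% (hK f), hs f]
    refine ⟨e.inv ≫ l, fun h => ?_, fun m hm => ?_⟩
    · simp [hi', hl h]
    · rw [← hu (e.hom ≫ m) fun h => ?_]
      · simp
      · simp only [← hm h, hi', Category.assoc, Iso.hom_inv_id_assoc]

end Isomorphisms

/-- Set-valued functors preserving finite limits preserve limits of finite graphs, in elementwise
form. -/
theorem IsGraphLimit.existsUnique_of_preservesFiniteLimits {H : Type} [Quiver.{0} H] [Finite H]
    [∀ a b : H, Finite (a ⟶ b)] {C : Type u} [Category.{v} C] {K : H ⥤q C} {X : C}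
    {c : ∀ h : H, X ⟶ K.obj h} (hc : IsGraphLimit K X c) (F : C ⥤ Type w)
    [PreservesFiniteLimits F] (x : ∀ h, F.obj (K.obj h))
    (hx : ∀ ⦃a b : H⦄ (f : a ⟶ b), F.map (K.map f) (x a) = x b) :
    ∃! z : F.obj X, ∀ h, F.map (c h) z = x h := by
  classical
  -- The free category on a finite graph can be infinite (one loop suffices), so the limit is
  -- rewritten over a finite shape: a left object for each vertex and a right object for each arrow
  -- `f : a ⟶ b`, at which `K.map f` on the `a`-component must agree with the identity on the
  -- `b`-component.
  let J : MulticospanShape.{0, 0} :=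
    { L := H
      R := Σ a b : H, (a ⟶ b)
      fst := fun r => r.1
      snd := fun r => r.2.1 }
  let : Fintype J.L := Fintype.ofFinite H
  let : Fintype J.R := Fintype.ofFinite (Σ a b : H, (a ⟶ b))
  let I : MulticospanIndex J C :=
    { left := K.obj
      right := fun r => K.obj r.2.1
      fst := fun r => K.map r.2.2
      snd := fun r => 𝟙 _ }
  let T : Multifork I := Multifork.ofι I X c fun r => by
    simpa [I] using hc.w r.2.2
  have key (E : Multifork I) : ∃! l : E.pt ⟶ X, ∀ h, l ≫ c h = E.ι h :=
    hc.existsUnique_lift E.pt E.ι fun a b f => by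
      simpa [I] using E.condition (⟨a, b, f⟩ : J.R)
  choose l hl hu using key
  have hT : IsLimit T := Multifork.IsLimit.mk T l (fun E h => hl E h) fun E m hm => hu E m hm
  let s : ∀ j : WalkingMulticospan J, F.obj (I.multicospan.obj j) := fun j =>
    match j with
    | .left h => x h
    | .right r => x r.2.1
  have hs : s ∈ (I.multicospan ⋙ F).sections := by
    intro i j f
    rcases f with _ | r | r
    · exact Functor.map_id_apply _ _ _
    · exact hx r.2.2
    · exact Functor.map_id_apply F (K.obj r.2.1) (x r.2.1)
  obtain ⟨z, hz, hz'⟩ := (Types.isLimit_iff _).1 ⟨isLimitOfPreserves F hT⟩ s hs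
  refine ⟨z, fun h => hz (.left h), fun y hy => hz' y ?_⟩
  rintro (h | r)
  · exact hy h
  · have e : T.π.app (.right r) = c r.1 ≫ K.map r.2.2 := (T.w (WalkingMulticospan.Hom.fst r)).symm
    change F.map (T.π.app (.right r)) y = x r.2.1
    rw [e, hc.w]
    exact hy _

/-! ### The pro-completion: maps to base objects and cofiltered limits -/

namespace ProCompletion

variable {C : Type u} [SmallCategory C]

/-- The Yoneda embedding of a category in its pro-completion. -/
def yoneda : C ⥤ ProCompletion C where
  obj c := op ⟨coyoneda.obj (op c), (inferInstance : PreservesFiniteLimits (coyoneda.obj (op c)))⟩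
  map f := (ObjectProperty.homMk (coyoneda.map f.op)).op
  map_id c := Quiver.Hom.unop_inj (ObjectProperty.hom_ext _ (by simp))
  map_comp f g := Quiver.Hom.unop_inj (ObjectProperty.hom_ext _ (by simp))

/-- Morphisms from a pro-object to an object of the base category are the elements of the
corresponding set-valued functor. -/
def homEquiv (T : ProCompletion C) (c : C) : (T ⟶ yoneda.obj c) ≃ T.unop.obj.obj c where
  toFun f := coyonedaEquiv (X := c) (F := T.unop.obj) f.unop.hom
  invFun x := Quiver.Hom.op (X := (yoneda.obj c).unop) (Y := T.unop)
    (ObjectProperty.homMk ((coyonedaEquiv (X := c) (F := T.unop.obj)).symm x))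
  left_inv f := Quiver.Hom.unop_inj (ObjectProperty.hom_ext _
    ((coyonedaEquiv (X := c) (F := T.unop.obj)).symm_apply_apply f.unop.hom))
  right_inv x := (coyonedaEquiv (X := c) (F := T.unop.obj)).apply_symm_apply x

theorem homEquiv_comp {T T' : ProCompletion C} (g : T ⟶ T') {c : C} (f : T' ⟶ yoneda.obj c) :
    homEquiv T c (g ≫ f) = g.unop.hom.app c (homEquiv T' c f) :=
  rfl

theorem homEquiv_comp_yoneda_map {T : ProCompletion C} {c d : C} (f : T ⟶ yoneda.obj c)
    (u : c ⟶ d) : homEquiv T d (f ≫ yoneda.map u) = T.unop.obj.map u (homEquiv T c f) := by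
  exact (coyonedaEquiv_naturality f.unop.hom u).symm

/-- Two morphisms of pro-objects agree if they agree after composition with all morphisms to
objects of the base category. -/
theorem hom_ext {S T : ProCompletion C} {f g : S ⟶ T}
    (h : ∀ (c : C) (x : T ⟶ yoneda.obj c), f ≫ x = g ≫ x) : f = g := by
  refine Quiver.Hom.unop_inj (ObjectProperty.hom_ext _ ?_)
  ext c x
  have := congrArg (homEquiv S c) (h c ((homEquiv T c).symm x))
  rwa [homEquiv_comp, homEquiv_comp, Equiv.apply_symm_apply] at this

/-- A morphism of pro-objects from its natural action on morphisms to objects of the base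
category. -/
theorem exists_hom {S T : ProCompletion C} (φ : ∀ c, (T ⟶ yoneda.obj c) → (S ⟶ yoneda.obj c))
    (hφ : ∀ (c d : C) (u : c ⟶ d) (x : T ⟶ yoneda.obj c),
      φ d (x ≫ yoneda.map u) = φ c x ≫ yoneda.map u) :
    ∃ f : S ⟶ T, ∀ c x, f ≫ x = φ c x := by
  -- Through `homEquiv`, the family `φ` is a natural transformation from the functor `T` to the
  -- functor `S`, hence a morphism `S ⟶ T` in the opposite category.
  let n : T.unop.obj ⟶ S.unop.obj :=
    { app := fun c => ↾(fun x => homEquiv S c (φ c ((homEquiv T c).symm x)))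
      naturality := by
        intro c d u
        ext x
        obtain ⟨x, rfl⟩ := (homEquiv T c).surjective x
        have := congrArg (homEquiv S d) (hφ c d u x)
        rw [homEquiv_comp_yoneda_map] at this
        simp [← homEquiv_comp_yoneda_map, ← hφ] }
  refine ⟨(ObjectProperty.homMk n).op, fun c x => (homEquiv S c).injective ?_⟩
  rw [homEquiv_comp]
  change homEquiv S c (φ c ((homEquiv T c).symm (homEquiv T c x))) = _
  rw [Equiv.symm_apply_apply]

/-- A cocone of a graph-indexed diagram of pro-objects is colimiting if its universal property
holds with respect to objects of the base category. -/
theorem isGraphColimit_of_yoneda {H : Type w} [Quiver.{w} H] {K : H ⥤q ProCompletion C}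
    {X : ProCompletion C} {c : ∀ h : H, K.obj h ⟶ X}
    (hw : ∀ ⦃a b : H⦄ (f : a ⟶ b), K.map f ≫ c b = c a)
    (hc : ∀ (d : C) (s : ∀ h : H, K.obj h ⟶ yoneda.obj d),
      (∀ ⦃a b : H⦄ (f : a ⟶ b), K.map f ≫ s b = s a) →
        ∃! l : X ⟶ yoneda.obj d, ∀ h, c h ≫ l = s h) : IsGraphColimit K X c := by
  refine ⟨hw, fun Y s hs => ?_⟩
  -- Each `x : Y ⟶ yoneda.obj d` turns `s` into a cocone on a base object. Uniqueness makes the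
  -- resulting factorizations natural in `d`, so they come from a single morphism `X ⟶ Y`.
  choose φ hφ hφ' using fun d (x : Y ⟶ yoneda.obj d) => hc d (fun h => s h ≫ x) fun a b f => by
    rw [← Category.assoc, hs f]
  obtain ⟨l, hl⟩ := exists_hom φ fun d e u x => (hφ' _ _ _ fun h => by
    rw [← Category.assoc, hφ, Category.assoc]).symm
  refine ⟨l, fun h => hom_ext fun d x => ?_, fun m hm => hom_ext fun d x => ?_⟩
  · rw [Category.assoc, hl, hφ]
  · rw [hl]
    exact hφ' _ _ _ fun h => by rw [← Category.assoc, hm]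

/-- Limits of finite graphs in the base category are limits in the pro-completion. -/
theorem _root_.IsGraphLimit.yoneda {H : Type} [Quiver.{0} H] [Finite H]
    [∀ a b : H, Finite (a ⟶ b)] {K : H ⥤q C} {X : C} {c : ∀ h : H, X ⟶ K.obj h}
    (hc : IsGraphLimit K X c) (T : ProCompletion C) (s : ∀ h, T ⟶ yoneda.obj (K.obj h))
    (hs : ∀ ⦃a b : H⦄ (f : a ⟶ b), s a ≫ yoneda.map (K.map f) = s b) :
    ∃! l : T ⟶ yoneda.obj X, ∀ h, l ≫ yoneda.map (c h) = s h := by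
  have : PreservesFiniteLimits T.unop.obj := T.unop.property
  obtain ⟨z, hz, hz'⟩ := hc.existsUnique_of_preservesFiniteLimits T.unop.obj
    (fun h => homEquiv T _ (s h)) fun a b f => by rw [← homEquiv_comp_yoneda_map, hs]
  refine ⟨(homEquiv T X).symm z, fun h => (homEquiv T _).injective ?_, fun m hm => ?_⟩
  · rw [homEquiv_comp_yoneda_map, Equiv.apply_symm_apply, hz]
  · rw [Equiv.eq_symm_apply]
    exact hz' _ fun h => by rw [← homEquiv_comp_yoneda_map, hm]

/-- By `homEquiv`, maps from `T` into `yoneda` form the functor `T` itself, which preserves finite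
limits; maps out of all objects `T` jointly detect limits. -/
instance : PreservesFiniteLimits (yoneda : C ⥤ ProCompletion C) where
  preservesFiniteLimits J _ _ :=
    { preservesLimit := fun {F} =>
        { preserves := fun {t} ht => ⟨coyonedaJointlyReflectsLimits _ _ fun T => by
            have : PreservesFiniteLimits T.unop.unop.obj := T.unop.unop.property
            let e : yoneda ⋙ coyoneda.obj T ≅ T.unop.unop.obj :=
              NatIso.ofComponents (fun c => (homEquiv T.unop c).toIso) fun {c d} u => by
                ext f
                exact homEquiv_comp_yoneda_map f u
            have : PreservesLimit F (yoneda ⋙ coyoneda.obj T) := preservesLimit_of_natIso _ e.symm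
            exact isLimitOfPreserves (yoneda ⋙ coyoneda.obj T) ht⟩ } }

section CofilteredLimits

variable {J : Type u} [SmallCategory J] [IsCofiltered J] (Q : J ⥤ C)

/-- A filtered colimit of representable functors preserves finite limits, since filtered colimits of
sets commute with finite limits. Hence the colimit is itself a pro-object. -/
theorem preservesFiniteLimits_colimit :
    PreservesFiniteLimits (colimit (Q.op ⋙ coyoneda)) := by
  have : PreservesFiniteLimits (Q.op ⋙ coyoneda).flip :=
    preservesFiniteLimits_of_evaluation _ fun j =>
      (inferInstance : PreservesFiniteLimits (coyoneda.obj (op (Q.obj j.unop))))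
  exact preservesFiniteLimits_of_natIso (colimitIsoFlipCompColim (Q.op ⋙ coyoneda)).symm

/-- The limit in the pro-completion of a cofiltered diagram in the base category. -/
noncomputable def lim : ProCompletion C :=
  op ⟨colimit (Q.op ⋙ coyoneda), preservesFiniteLimits_colimit Q⟩

/-- The projections of a cofiltered limit in the pro-completion. -/
noncomputable def lim.π (j : J) : lim Q ⟶ yoneda.obj (Q.obj j) :=
  Quiver.Hom.op (X := (yoneda.obj (Q.obj j)).unop) (Y := (lim Q).unop)
    (ObjectProperty.homMk (colimit.ι (Q.op ⋙ coyoneda) (op j)))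

theorem lim.w {i j : J} (f : i ⟶ j) : lim.π Q i ≫ yoneda.map (Q.map f) = lim.π Q j :=
  Quiver.Hom.unop_inj (ObjectProperty.hom_ext _ (colimit.w (Q.op ⋙ coyoneda) f.op))

/-- The pro-completion is the opposite of a full subcategory of all set-valued functors, so this is
the universal property of the colimit of functors. -/
theorem lim.existsUnique_lift (T : ProCompletion C) (s : ∀ j, T ⟶ yoneda.obj (Q.obj j))
    (hs : ∀ ⦃i j : J⦄ (f : i ⟶ j), s i ≫ yoneda.map (Q.map f) = s j) :
    ∃! l : T ⟶ lim Q, ∀ j, l ≫ lim.π Q j = s j := by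
  let t : Cocone (Q.op ⋙ coyoneda) :=
    { pt := T.unop.obj
      ι :=
        { app := fun j => (s j.unop).unop.hom
          naturality := fun i j f => by
            have := congrArg (fun x => x.unop.hom) (hs f.unop)
            exact this.trans (Category.comp_id _).symm } }
  refine ⟨(ObjectProperty.homMk (colimit.desc _ t)).op, fun j => ?_, fun m hm => ?_⟩
  · exact Quiver.Hom.unop_inj (ObjectProperty.hom_ext _ (colimit.ι_desc t (op j)))
  · refine Quiver.Hom.unop_inj (ObjectProperty.hom_ext _ (colimit.hom_ext fun j => ?_))
    refine Eq.trans ?_ (colimit.ι_desc t j).symm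
    exact congrArg (fun x => x.unop.hom) (hm j.unop)

/-- Maps from a cofiltered limit to an object of the base category form the filtered colimit of
the sets of maps from the terms. -/
theorem lim.exists_bijective (c : C) :
    ∃ θ : colimit (Q.op ⋙ CategoryTheory.yoneda.obj c) → (lim Q ⟶ yoneda.obj c),
      Function.Bijective θ ∧ ∀ (j : J) (u : Q.obj j ⟶ c),
        θ (colimit.ι (Q.op ⋙ CategoryTheory.yoneda.obj c) (op j) u) =
          lim.π Q j ≫ yoneda.map u := by
  -- Colimits of functors are pointwise, so the value of the functor `lim Q` at `c` is the colimit
  -- of the sets of maps `Q.obj j ⟶ c`.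
  let e := preservesColimitIso ((evaluation C (Type u)).obj c) (Q.op ⋙ coyoneda)
  let f : colimit (Q.op ⋙ CategoryTheory.yoneda.obj c) ≃ (lim Q).unop.obj.obj c :=
    e.symm.toEquiv
  have hf (j : J) (u : Q.obj j ⟶ c) :
      f (colimit.ι (Q.op ⋙ CategoryTheory.yoneda.obj c) (op j) u) =
        (colimit.ι (Q.op ⋙ coyoneda) (op j)).app c u :=
    ConcreteCategory.congr_hom
      (ι_preservesColimitIso_inv ((evaluation C (Type u)).obj c) (Q.op ⋙ coyoneda) (op j)) u
  refine ⟨f.trans (homEquiv _ c).symm, Equiv.bijective _, fun j u => ?_⟩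
  rw [Equiv.trans_apply, Equiv.symm_apply_eq, hf, homEquiv_comp_yoneda_map]
  exact (map_coyonedaEquiv (lim.π Q j).unop.hom u).symm

end CofilteredLimits

end ProCompletion

/-! ### Commutativity under functors and isomorphisms, and pointwise limits of set-valued functors
-/

namespace CommCondition

variable {V : Type} [Quiver.{0} V] {C : Type u} [Category.{v} C]

theorem composePath_mapPath_comp_functor {D : Type*} [Category* D] (G : V ⥤q C) (F : C ⥤ D)
    {a b : V} (p : Quiver.Path a b) :
    composePath ((G ⋙q F.toPrefunctor).mapPath p) = F.map (composePath (G.mapPath p)) := by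
  induction p with
  | nil => exact (F.map_id _).symm
  | cons p e ih => exact (congrArg (· ≫ F.map (G.map e)) ih).trans (F.map_comp _ _).symm

theorem Holds.comp_functor {D : Type*} [Category* D] {c : CommCondition V} {G : V ⥤q C}
    (h : c.Holds G) (F : C ⥤ D) : c.Holds (G ⋙q F.toPrefunctor) := by
  simp only [Holds, composePath_mapPath_comp_functor] at h ⊢
  rw [h]

theorem holds_of_iso {c : CommCondition V} {G G' : V ⥤q C} (i : ∀ a, G.obj a ≅ G'.obj a)
    (hi : ∀ ⦃a b : V⦄ (f : a ⟶ b), G.map f ≫ (i b).hom = (i a).hom ≫ G'.map f)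
    (h : c.Holds G) : c.Holds G' := by
  have key {a b : V} (p : Quiver.Path a b) :
      composePath (G.mapPath p) ≫ (i b).hom = (i a).hom ≫ composePath (G'.mapPath p) := by
    induction p with
    | nil => simp
    | cons p e ih =>
      simp only [Prefunctor.mapPath_cons, composePath_cons, Category.assoc, hi, reassoc_of% ih]
  have := key c.left
  rw [h, key c.right, Iso.cancel_iso_hom_left] at this
  exact this.symm

end CommCondition

/-- Limits of graph-indexed diagrams of set-valued functors can be checked pointwise. -/
theorem isGraphLimit_of_existsUnique_app {H : Type w} [Quiver.{w} H] {J : Type*} [Category* J]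
    {K : H ⥤q (J ⥤ Type u)} {X : J ⥤ Type u} {c : ∀ h : H, X ⟶ K.obj h}
    (hw : ∀ ⦃a b : H⦄ (f : a ⟶ b), c a ≫ K.map f = c b)
    (hc : ∀ (j : J) (x : ∀ h, (K.obj h).obj j),
      (∀ ⦃a b : H⦄ (f : a ⟶ b), (K.map f).app j (x a) = x b) →
        ∃! z : X.obj j, ∀ h, (c h).app j z = x h) : IsGraphLimit K X c := by
  refine ⟨hw, fun Y s hs => ?_⟩
  choose φ hφ hφ' using fun j (y : Y.obj j) => hc j (fun h => (s h).app j y) fun a b f => by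
    rw [← hs f]; rfl
  refine ⟨{ app := fun j => ↾(φ j), naturality := fun i j f => ?_ }, fun h => ?_, fun m hm => ?_⟩
  · ext y
    refine (hφ' j _ _ fun h => ?_).symm
    change (c h).app j (X.map f (φ i y)) = _
    rw [NatTrans.naturality_apply, hφ]
    exact ((s h).naturality_apply f y).symm
  · ext j y
    exact hφ j y h
  · ext j y
    exact hφ' j y _ fun h => by rw [← hm]; rfl

/-! ### Cofiltered limits preserve finite limits and finite colimits -/

namespace ProCompletion

variable {C : Type u} [SmallCategory C]

section CofilteredLimits

variable {J : Type u} [SmallCategory J] [IsCofiltered J]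

theorem lim.hom_ext {Q : J ⥤ C} {T : ProCompletion C} {f g : T ⟶ lim Q}
    (h : ∀ j, f ≫ lim.π Q j = g ≫ lim.π Q j) : f = g :=
  (lim.existsUnique_lift Q T (fun j => g ≫ lim.π Q j) fun i j f => by
    rw [Category.assoc, lim.w]).unique h fun _ => rfl

/-- The morphism to a cofiltered limit induced by a cone. -/
noncomputable def lim.lift {Q : J ⥤ C} {T : ProCompletion C} (s : ∀ j, T ⟶ yoneda.obj (Q.obj j))
    (hs : ∀ ⦃i j : J⦄ (f : i ⟶ j), s i ≫ yoneda.map (Q.map f) = s j) : T ⟶ lim Q :=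
  (lim.existsUnique_lift Q T s hs).choose

@[simp]
theorem lim.lift_π {Q : J ⥤ C} {T : ProCompletion C} (s : ∀ j, T ⟶ yoneda.obj (Q.obj j))
    (hs : ∀ ⦃i j : J⦄ (f : i ⟶ j), s i ≫ yoneda.map (Q.map f) = s j) (j : J) :
    lim.lift s hs ≫ lim.π Q j = s j :=
  (lim.existsUnique_lift Q T s hs).choose_spec.1 j

variable (C J) in
/-- The functor sending a cofiltered diagram in the base category to its limit in the
pro-completion. -/
noncomputable abbrev limFunctor : (J ⥤ C) ⥤ ProCompletion C where
  obj Q := lim Q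
  map {Q Q'} α := lim.lift (fun j => lim.π Q j ≫ yoneda.map (α.app j)) fun i j f => by
    rw [Category.assoc, ← Functor.map_comp, ← α.naturality, Functor.map_comp, ← Category.assoc,
      lim.w]
  map_id Q := lim.hom_ext fun j => by simp
  map_comp α β := lim.hom_ext fun j => by
    rw [lim.lift_π, Category.assoc, lim.lift_π, ← Category.assoc, lim.lift_π, NatTrans.comp_app,
      Functor.map_comp, Category.assoc]

theorem limFunctor_map_π {Q Q' : J ⥤ C} (α : Q ⟶ Q') (j : J) :
    (limFunctor C J).map α ≫ lim.π Q' j = lim.π Q j ≫ yoneda.map (α.app j) :=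
  lim.lift_π _ (fun i j f => by
    rw [Category.assoc, ← Functor.map_comp, ← α.naturality, Functor.map_comp, ← Category.assoc,
      lim.w]) _

variable {H : Type} [Quiver.{0} H] [Finite H] [∀ a b : H, Finite (a ⟶ b)] {K : H ⥤q (J ⥤ C)}
  {X : J ⥤ C}

/-- Cofiltered limits in the pro-completion preserve limits of finite graphs. -/
theorem isGraphLimit_limFunctor {c : ∀ h : H, X ⟶ K.obj h}
    (hc : ∀ j, IsGraphLimit (K ⋙q ((evaluation J C).obj j).toPrefunctor) (X.obj j)
      (fun h => (c h).app j)) :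
    IsGraphLimit (K ⋙q (limFunctor C J).toPrefunctor) ((limFunctor C J).obj X)
      (fun h => (limFunctor C J).map (c h)) := by
  refine ⟨fun a b f => ?_, fun T s hs => ?_⟩
  · refine ((limFunctor C J).map_comp _ _).symm.trans (congrArg _ ?_)
    ext j
    exact (hc j).w f
  · change ∀ h, T ⟶ lim (K.obj h) at s
    replace hs ⦃a b : H⦄ (f : a ⟶ b) : s a ≫ (limFunctor C J).map (K.map f) = s b := hs f
    -- Limits of finite graphs in the base stay limits against the pro-object `T`, so lifts exist at
    -- each level; their uniqueness makes them compatible in `j`.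
    have hsj (j : J) : ∃! l : T ⟶ yoneda.obj (X.obj j),
        ∀ h, l ≫ yoneda.map ((c h).app j) = s h ≫ lim.π (K.obj h) j :=
      (hc j).yoneda T (fun h => s h ≫ lim.π (K.obj h) j) fun a b f => by
        change (s a ≫ lim.π (K.obj a) j) ≫ yoneda.map ((K.map f).app j) = s b ≫ lim.π (K.obj b) j
        rw [← hs f, Category.assoc, Category.assoc, limFunctor_map_π]
    choose l hl hl' using hsj
    refine ⟨lim.lift l fun i j f => hl' _ _ fun h => ?_, fun h => lim.hom_ext fun j => ?_,
      fun m hm => lim.hom_ext fun j => ?_⟩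
    · rw [Category.assoc, ← Functor.map_comp, (c h).naturality, Functor.map_comp, ← Category.assoc,
        hl, Category.assoc, lim.w]
    · change (lim.lift l _ ≫ (limFunctor C J).map (c h)) ≫ lim.π (K.obj h) j = _
      rw [Category.assoc, limFunctor_map_π, ← Category.assoc, lim.lift_π, hl]
    · rw [lim.lift_π]
      refine hl' _ _ fun h => ?_
      replace hm (h : H) : m ≫ (limFunctor C J).map (c h) = s h := hm h
      rw [← hm, Category.assoc, Category.assoc, limFunctor_map_π]

/-- Cofiltered limits in the pro-completion preserve colimits of finite graphs. -/
theorem isGraphColimit_limFunctor {c : ∀ h : H, K.obj h ⟶ X}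
    (hc : ∀ j, IsGraphColimit (K ⋙q ((evaluation J C).obj j).toPrefunctor) (X.obj j)
      (fun h => (c h).app j)) :
    IsGraphColimit (K ⋙q (limFunctor C J).toPrefunctor) ((limFunctor C J).obj X)
      (fun h => (limFunctor C J).map (c h)) := by
  have hw ⦃a b : H⦄ (f : a ⟶ b) : K.map f ≫ c b = c a := by
    ext j
    exact (hc j).w f
  refine isGraphColimit_of_yoneda (fun a b f =>
    ((limFunctor C J).map_comp _ _).symm.trans (congrArg _ (hw f))) fun d s hs => ?_
  -- `P` sends `Q` to the sets of maps `Q.obj j ⟶ d`. It turns the levelwise colimit into a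
  -- pointwise limit over the opposite graph, which the filtered colimit functor preserves; the
  -- bijections `θ` then identify these filtered colimits with the maps `lim Q ⟶ yoneda.obj d`.
  let P : (J ⥤ C)ᵒᵖ ⥤ (Jᵒᵖ ⥤ Type u) :=
    { obj := fun Q => Q.unop.op ⋙ CategoryTheory.yoneda.obj d
      map := fun α => Functor.whiskerRight (NatTrans.op α.unop) _ }
  let K' : Hᵒᵖ ⥤q (Jᵒᵖ ⥤ Type u) :=
    { obj := fun h => P.obj (op (K.obj h.unop))
      map := fun f => P.map (K.map f.unop).op }
  have hK' : IsGraphLimit K' (P.obj (op X)) (fun h => P.map (c h.unop).op) := by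
    refine isGraphLimit_of_existsUnique_app (fun a b f => ?_) fun j x hx => ?_
    · rw [← hw f.unop, op_comp, P.map_comp]
    · obtain ⟨z, hz, hz'⟩ := (hc j.unop).existsUnique_desc d (fun h => x (op h))
        fun a b f => hx f.op
      exact ⟨z, fun h => hz h.unop, fun y hy => hz' y fun h => hy (op h)⟩
  have : Finite Hᵒᵖ := Finite.of_equiv _ equivToOpposite
  have : ∀ a b : Hᵒᵖ, Finite (a ⟶ b) := fun a b =>
    Finite.of_equiv _ (Quiver.Hom.opEquiv (X := b.unop) (Y := a.unop))
  choose θ hθ hθπ using fun Q : J ⥤ C => lim.exists_bijective Q d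
  have hθ_map {Q Q' : J ⥤ C} (α : Q ⟶ Q') (x : colim.obj (P.obj (op Q'))) :
      θ Q (colim.map (P.map α.op) x) = (limFunctor C J).map α ≫ θ Q' x := by
    obtain ⟨j, u, rfl⟩ := Types.jointly_surjective _ (colimit.isColimit (P.obj (op Q'))) x
    have h1 : colim.map (P.map α.op) (colimit.ι (P.obj (op Q')) j u) =
        colimit.ι (P.obj (op Q)) j (α.app j.unop ≫ u) :=
      ConcreteCategory.congr_hom (ι_colimMap (P.map α.op) j) u
    refine (congrArg _ h1).trans ((hθπ Q j.unop _).trans ?_)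
    refine Eq.trans ?_ (congrArg _ (hθπ Q' j.unop u).symm)
    rw [← Category.assoc, limFunctor_map_π, Functor.map_comp, Category.assoc]
  choose x hx using fun h => (hθ (K.obj h)).surjective (s h)
  obtain ⟨z, hz, hz'⟩ := hK'.existsUnique_of_preservesFiniteLimits colim (fun h => x h.unop)
    fun a b f => (hθ _).injective <| by
      refine (hθ_map _ _).trans ?_
      rw [hx, hx]
      exact hs f.unop
  refine ⟨θ X z, fun h => ?_, fun m hm => ?_⟩
  · refine (hθ_map (c h) z).symm.trans ?_
    rw [← hx]
    exact congrArg _ (hz (op h))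
  · obtain ⟨y, rfl⟩ := (hθ X).surjective m
    refine congrArg _ (hz' y fun h => (hθ _).injective ?_)
    rw [hx, ← hm]
    exact hθ_map _ _

end CofilteredLimits

end ProCompletion

/-! ### Structures: replacement of objects, strictification, fibres, and functors as structures -/

namespace Sketch

section Transport

variable {S : Sketch} {C : Type u} [Category.{v} C]

namespace Structure

@[simp]
theorem id_app (F : Structure S C) (a : S.V) : Hom.app (𝟙 F) a = 𝟙 (F.graph.obj a) := rfl

@[simp]
theorem comp_app {F G K : Structure S C} (m : F ⟶ G) (n : G ⟶ K) (a : S.V) :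
    Hom.app (m ≫ n) a = Hom.app m a ≫ Hom.app n a := rfl

theorem hom_ext {F G : Structure S C} {m n : F ⟶ G} (h : ∀ a, Hom.app m a = Hom.app n a) : m = n :=
  Hom.ext (funext h)

theorem hom_app_eqToHom {F G : Structure S C} (h : F = G) (a : S.V) :
    Hom.app (eqToHom h) a = eqToHom (by rw [h]) := by
  subst h
  rfl

theorem eq_of_graph_eq {F G : Structure S C} (h : F.graph = G.graph) : F = G := by
  cases F
  cases G
  cases h
  rfl

/-- The functor of evaluation at a vertex. -/
@[simps]
def eval (C : Type u) [Category.{v} C] (b : S.V) : Structure S C ⥤ C where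
  obj F := F.graph.obj b
  map m := Hom.app m b

/-- The natural transformation between evaluations at the endpoints of an arrow. -/
@[simps]
def evalMap (C : Type u) [Category.{v} C] {a b : S.V} (f : a ⟶ b) : eval C a ⟶ eval C b where
  app F := F.graph.map f
  naturality _ _ m := (Hom.naturality m f).symm

/-- An isomorphism of structures from a natural family of isomorphisms. -/
@[simps]
def isoMk {F G : Structure S C} (i : ∀ a, F.graph.obj a ≅ G.graph.obj a)
    (hi : ∀ ⦃a b : S.V⦄ (f : a ⟶ b), F.graph.map f ≫ (i b).hom = (i a).hom ≫ G.graph.map f) :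
    F ≅ G where
  hom := { app := fun a => (i a).hom, naturality := hi }
  inv :=
    { app := fun a => (i a).inv
      naturality := fun a b f => by
        rw [Iso.comp_inv_eq, Category.assoc, hi, Iso.inv_hom_id_assoc] }
  hom_inv_id := hom_ext fun a => (i a).hom_inv_id
  inv_hom_id := hom_ext fun a => (i a).inv_hom_id

/-- The structure obtained by replacing all objects of a given structure by isomorphic ones. -/
@[simps graph_obj graph_map]
def replace (F : Structure S C) (q : ∀ b, Σ Y : C, F.graph.obj b ≅ Y) : Structure S C where
  graph :=
    { obj := fun b => (q b).1
      map := fun {a b} f => (q a).2.inv ≫ F.graph.map f ≫ (q b).2.hom }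
  comm c hc := CommCondition.holds_of_iso (fun b => (q b).2)
    (fun _ _ _ => (Iso.hom_inv_id_assoc _ _).symm) (F.comm c hc)
  lim t ht := (t.holds_iff _).2 <| ((t.holds_iff _).1 (F.lim t ht)).of_iso _ (q _).2
    (fun h => (q (t.D.obj h)).2) (fun _ _ _ => (Iso.hom_inv_id_assoc _ _).symm)
    fun _ => (Iso.hom_inv_id_assoc _ _).symm
  colim t ht := (t.holds_iff _).2 <| ((t.holds_iff _).1 (F.colim t ht)).of_iso _ (q _).2
    (fun h => (q (t.D.obj h)).2) (fun _ _ _ => (Iso.hom_inv_id_assoc _ _).symm)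
    fun _ => (Iso.hom_inv_id_assoc _ _).symm

/-- The functor obtained by replacing all objects of the values of a given functor to structures by
isomorphic ones. -/
@[simps]
def replaceFunctor {M : Type*} [Category* M] (E : M ⥤ Structure S C)
    (q : ∀ X b, Σ Y : C, (E.obj X).graph.obj b ≅ Y) : M ⥤ Structure S C where
  obj X := (E.obj X).replace (q X)
  map {X Y} m :=
    { app := fun b => (q X b).2.inv ≫ Hom.app (E.map m) b ≫ (q Y b).2.hom
      naturality := fun a b f => by
        change ((q X a).2.inv ≫ (E.obj X).graph.map f ≫ (q X b).2.hom) ≫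
            (q X b).2.inv ≫ Hom.app (E.map m) b ≫ (q Y b).2.hom =
          ((q X a).2.inv ≫ Hom.app (E.map m) a ≫ (q Y a).2.hom) ≫
            (q Y a).2.inv ≫ (E.obj Y).graph.map f ≫ (q Y b).2.hom
        simp [reassoc_of% (Hom.naturality (E.map m) f)] }
  map_id X := hom_ext fun b => by
    change (q X b).2.inv ≫ Hom.app (E.map (𝟙 X)) b ≫ (q X b).2.hom = 𝟙 (q X b).1
    simp
  map_comp {X Y Z} m n := hom_ext fun b => by
    change (q X b).2.inv ≫ Hom.app (E.map (m ≫ n)) b ≫ (q Z b).2.hom =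
      ((q X b).2.inv ≫ Hom.app (E.map m) b ≫ (q Y b).2.hom) ≫
        (q Y b).2.inv ≫ Hom.app (E.map n) b ≫ (q Z b).2.hom
    simp

end Structure

end Transport

section Strictification

variable {A B : Sketch} {φ : Hom A B} {D : Type u} [Category.{v} D]

open Structure in
/-- A right inverse up to isomorphism of the restriction functor along a subsketch inclusion can be
replaced by a strict one. -/
theorem exists_comp_restrict_eq_id (hφ : φ.IsInclusion) (E : Structure A D ⥤ Structure B D)
    (e : E ⋙ φ.restrict D ≅ 𝟭 _) :
    ∃ E' : Structure A D ⥤ Structure B D, E' ⋙ φ.restrict D = 𝟭 _ := by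
  classical
  let i (X : Structure A D) (a : A.V) : (E.obj X).graph.obj (φ.graph.obj a) ≅ X.graph.obj a :=
    (eval D a).mapIso (e.app X)
  have hi (X : Structure A D) ⦃a b : A.V⦄ (f : a ⟶ b) :
      (E.obj X).graph.map (φ.graph.map f) ≫ (i X b).hom = (i X a).hom ≫ X.graph.map f :=
    Hom.naturality (e.hom.app X) f
  have hi' {X Y : Structure A D} (m : X ⟶ Y) (a : A.V) :
      Hom.app (E.map m) (φ.graph.obj a) ≫ (i Y a).hom = (i X a).hom ≫ Hom.app m a :=
    congrArg (fun n => Hom.app n a) (e.hom.naturality m)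
  -- At a vertex in the image the new object is the one prescribed by `X`; it is well defined
  -- because the inclusion is injective on vertices. Elsewhere the object is kept.
  have hq (X : Structure A D) (b : B.V) : ∃ q : Σ Y : D, (E.obj X).graph.obj b ≅ Y,
      ∀ (a : A.V) (h : φ.graph.obj a = b), q = ⟨X.graph.obj a, eqToIso (by rw [h]) ≪≫ i X a⟩ := by
    by_cases h : ∃ a, φ.graph.obj a = b
    · obtain ⟨a, rfl⟩ := h
      refine ⟨⟨X.graph.obj a, i X a⟩, fun a' h' => ?_⟩
      obtain rfl := hφ.1 h'
      simp
    · exact ⟨⟨_, Iso.refl _⟩, fun a ha => (h ⟨a, ha⟩).elim⟩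
  choose q hq using hq
  have hq' : (fun X a => q X (φ.graph.obj a)) = fun X a => ⟨X.graph.obj a, i X a⟩ := by
    funext X a
    rw [hq X _ a rfl]
    simp
  have key : replaceFunctor (E ⋙ φ.restrict D) (fun X a => ⟨X.graph.obj a, i X a⟩) = 𝟭 _ := by
    have h (X : Structure A D) :
        (replaceFunctor (E ⋙ φ.restrict D) (fun X a => ⟨X.graph.obj a, i X a⟩)).obj X = X := by
      refine eq_of_graph_eq (Prefunctor.ext (fun a => rfl) fun a b f => ?_)
      change (i X a).inv ≫ (E.obj X).graph.map (φ.graph.map f) ≫ (i X b).hom = X.graph.map f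
      rw [hi, Iso.inv_hom_id_assoc]
    refine CategoryTheory.Functor.ext h fun X Y m => hom_ext fun a => ?_
    rw [comp_app, comp_app, hom_app_eqToHom, hom_app_eqToHom]
    change (i X a).inv ≫ Hom.app (E.map m) (φ.graph.obj a) ≫ (i Y a).hom =
      𝟙 _ ≫ Hom.app m a ≫ 𝟙 _
    rw [hi', Iso.inv_hom_id_assoc, Category.id_comp, Category.comp_id]
  refine ⟨replaceFunctor E q, ?_⟩
  -- Restriction sees `q` only at vertices in the image, so restricting after replacement is, by
  -- definition, replacing the restricted functor along `q X (φ.graph.obj a)`.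
  exact (congrArg (fun r => replaceFunctor (E ⋙ φ.restrict D) r) hq').trans key

end Strictification

section EmptySketch

variable {D : Type u} [Category.{v} D]

instance : Subsingleton (Structure empty D) where
  allEq _ _ := Structure.eq_of_graph_eq <|
    Prefunctor.ext (fun a : Empty => a.elim) fun a : Empty => a.elim

instance (F G : Structure empty D) : Subsingleton (F ⟶ G) where
  allEq _ _ := Structure.hom_ext fun a : Empty => a.elim

/-- The functor from structures to the fibre over the unique structure of type the empty sketch. -/
def toFibre {A : Sketch} (α : Hom empty A) (D : Type u) [Category.{v} D] :
    Structure A D ⥤ (α.restrict D).Fiber (emptyStructure D) :=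
  Functor.Fiber.inducedFunctor (F := 𝟭 _)
    (CategoryTheory.Functor.ext (fun _ => Subsingleton.elim _ _) fun _ _ _ => Subsingleton.elim _ _)

theorem fiber_functor_ext {𝒳 𝒮 M : Type*} [Category* 𝒳] [Category* 𝒮] [Category* M] {p : 𝒳 ⥤ 𝒮}
    {S : 𝒮} {F G : M ⥤ p.Fiber S}
    (h : F ⋙ Functor.Fiber.fiberInclusion = G ⋙ Functor.Fiber.fiberInclusion) : F = G :=
  CategoryTheory.Functor.ext (fun X => Functor.Fiber.fiberInclusion_obj_inj (CategoryTheory.Functor.congr_obj h X))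
    fun X Y m => Functor.Fiber.hom_ext <| by
      rw [Functor.map_comp, Functor.map_comp, eqToHom_map, eqToHom_map]
      exact CategoryTheory.Functor.congr_hom h m

/-- The category of structures of type the empty sketch has one object and only its identity, so the
fibres over it carry the same data as the full categories of structures. -/
theorem Sequent.holdsFunctorially_iff (s : Sequent empty) :
    s.HoldsFunctorially D ↔
      ∃ E : Structure s.A D ⥤ Structure s.B D, E ⋙ s.β.restrict D = 𝟭 _ := by
  constructor
  · rintro ⟨Φ, hΦ⟩
    refine ⟨toFibre s.α D ⋙ Φ ⋙ Functor.Fiber.fiberInclusion, ?_⟩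
    exact congrArg (fun F => toFibre s.α D ⋙ F ⋙ Functor.Fiber.fiberInclusion) hΦ
  · rintro ⟨E, hE⟩
    refine ⟨Functor.Fiber.fiberInclusion ⋙ E ⋙ toFibre (s.α.comp s.β) D, fiber_functor_ext ?_⟩
    exact congrArg (fun F => Functor.Fiber.fiberInclusion ⋙ F) hE

end EmptySketch

section CategoryOn

variable {V : Type} [Quiver.{0} V]

/-- The vertices of a graph with a category structure, as the objects of the category. -/
def CategoryOn.Carrier (_ : CategoryOn V) : Type := V

instance (K : CategoryOn V) : SmallCategory K.Carrier where
  Hom a b := Quiver.Hom (V := V) a b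
  id := K.id
  comp := K.comp
  id_comp := K.id_comp
  comp_id := K.comp_id
  assoc := K.assoc

variable {A : Sketch} (K : CategoryOn A.V) (D : Type u) [Category.{v} D]

/-- Functors from a category are structures for the underlying sketch of the category. -/
def CategoryOn.toStructure (hc : A.comm = K.comms) (hl : A.lim = ∅) (hr : A.colim = ∅) :
    (K.Carrier ⥤ D) ⥤ Structure A D where
  obj G :=
    { graph :=
        { obj := fun a => G.obj a
          map := fun {a b} f => G.map (X := a) (Y := b) f }
      comm := by
        rw [hc]
        rintro c (⟨a, b, d, f, g, rfl⟩ | ⟨a, rfl⟩)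
        -- The composite of a path starts from the identity of the empty path, which accounts for
        -- the leading identities.
        · change (𝟙 _ ≫ G.map (X := a) (Y := b) f) ≫ G.map (X := b) (Y := d) g =
            𝟙 _ ≫ G.map (X := a) (Y := d) (K.comp f g)
          rw [Category.id_comp, Category.id_comp]
          exact (G.map_comp (X := a) (Y := b) (Z := d) f g).symm
        · exact (Category.id_comp _).trans (G.map_id (X := a))
      lim := by simp [hl]
      colim := by simp [hr] }
  map m :=
    { app := fun a => m.app a
      naturality := fun a b f => m.naturality (X := a) (Y := b) f }

/-- Structures for the underlying sketch of a category are functors. -/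
def CategoryOn.ofStructure (hc : A.comm = K.comms) : Structure A D ⥤ (K.Carrier ⥤ D) where
  obj F :=
    { obj := fun a => F.graph.obj a
      map := fun {a b} f => F.graph.map (X := a) (Y := b) f
      map_id := fun a => by
        have h : (⟨a, a, (K.id a).toPath, Quiver.Path.nil⟩ : CommCondition A.V) ∈ A.comm :=
          hc ▸ Or.inr ⟨a, rfl⟩
        exact (Category.id_comp _).symm.trans (F.comm _ h)
      map_comp := fun {a b c} f g => by
        have h : (⟨a, c, (Quiver.Hom.toPath (V := A.V) f).cons g, (K.comp f g).toPath⟩ :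
            CommCondition A.V) ∈ A.comm := hc ▸ Or.inl ⟨a, b, c, f, g, rfl⟩
        refine ((Category.id_comp _).symm.trans (F.comm _ h).symm).trans ?_
        exact congrArg (· ≫ F.graph.map g) (Category.id_comp (F.graph.map f)) }
  map m :=
    { app := fun a => Structure.Hom.app m a
      naturality := fun a b f => Structure.Hom.naturality m f }

end CategoryOn

end Sketch

/-! ### Extension of functors and structures by cofiltered limits over comma categories -/

namespace ProCompletion

variable {C : Type u} [SmallCategory C]

/-- A pro-object is determined by its maps to base objects: the inverse bijections are natural in
`c`, so `exists_hom` turns them into an inverse morphism. -/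
theorem isIso_of_bijective {S T : ProCompletion C} (f : S ⟶ T)
    (hf : ∀ c, Function.Bijective fun x : T ⟶ yoneda.obj c => f ≫ x) : IsIso f := by
  choose φ hφ using fun c => (hf c).surjective
  obtain ⟨g, hg⟩ := exists_hom φ fun c d u x => (hf d).injective <| by
    simp only [hφ]
    rw [← Category.assoc]
    exact congrArg (· ≫ yoneda.map u) (hφ c x).symm
  refine ⟨g, hom_ext fun c x => ?_, hom_ext fun c x => (hf c).injective ?_⟩
  · rw [Category.assoc, hg, Category.id_comp]
    exact hφ c x
  · simp only [Category.assoc, Category.id_comp, hg]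
    exact hφ c (f ≫ x)

section Extension

variable {M : Type u} [SmallCategory M] [HasFiniteLimits M] {N : Type w} [Category.{u} N]
  (F : M ⥤ N) [PreservesFiniteLimits F]

/-- A functor preserving finite limits on a category that has them is flat. This makes the limits
defining `extension` cofiltered. -/
instance (X : N) : IsCofiltered (StructuredArrow X F) :=
  (flat_of_preservesFiniteLimits F).cofiltered X

variable {F} in
/-- The projections of the value at `X` of the extension along `F` of a functor `T` to the
pro-completion. -/
noncomputable def extensionπ (T : M ⥤ C) {X : N} {G : M} (φ : X ⟶ F.obj G) :
    lim (StructuredArrow.proj X F ⋙ T) ⟶ yoneda.obj (T.obj G) :=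
  lim.π (StructuredArrow.proj X F ⋙ T) (StructuredArrow.mk φ)

variable {F} in
theorem extensionπ_comp (T : M ⥤ C) {X : N} {G G' : M} (φ : X ⟶ F.obj G) (g : G ⟶ G') :
    extensionπ T φ ≫ yoneda.map (T.map g) = extensionπ T (φ ≫ F.map g) :=
  lim.w (StructuredArrow.proj X F ⋙ T)
    (StructuredArrow.homMk g rfl : StructuredArrow.mk φ ⟶ StructuredArrow.mk (φ ≫ F.map g))

variable {F} in
theorem extension_hom_ext {T : M ⥤ C} {X : N} {S : ProCompletion C}
    {f g : S ⟶ lim (StructuredArrow.proj X F ⋙ T)}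
    (h : ∀ (G : M) (φ : X ⟶ F.obj G), f ≫ extensionπ T φ = g ≫ extensionπ T φ) : f = g :=
  lim.hom_ext fun j => h j.right j.hom

variable {F} in
/-- The morphism to the value of an extension induced by a compatible family. -/
noncomputable def extensionLift {T : M ⥤ C} {X : N} {S : ProCompletion C}
    (s : ∀ (G : M), (X ⟶ F.obj G) → (S ⟶ yoneda.obj (T.obj G)))
    (hs : ∀ (G G' : M) (φ : X ⟶ F.obj G) (g : G ⟶ G'),
      s G φ ≫ yoneda.map (T.map g) = s G' (φ ≫ F.map g)) :
    S ⟶ lim (StructuredArrow.proj X F ⋙ T) :=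
  lim.lift (fun j => s j.right j.hom) fun i j f => by
    rw [← StructuredArrow.w f]
    exact hs _ _ _ _

variable {F} in
@[simp]
theorem extensionLift_π {T : M ⥤ C} {X : N} {S : ProCompletion C}
    (s : ∀ (G : M), (X ⟶ F.obj G) → (S ⟶ yoneda.obj (T.obj G)))
    (hs : ∀ (G G' : M) (φ : X ⟶ F.obj G) (g : G ⟶ G'),
      s G φ ≫ yoneda.map (T.map g) = s G' (φ ≫ F.map g)) {G : M} (φ : X ⟶ F.obj G) :
    extensionLift s hs ≫ extensionπ T φ = s G φ :=
  lim.lift_π _ _ (StructuredArrow.mk φ)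

/-- The pointwise right Kan extension along a finite limit preserving functor `F` of a functor to
the base category, with values in the pro-completion. -/
noncomputable abbrev extension (T : M ⥤ C) : N ⥤ ProCompletion C where
  obj X := lim (StructuredArrow.proj X F ⋙ T)
  map {X Y} m := extensionLift (fun G φ => extensionπ T (m ≫ φ)) fun G G' φ g => by
    rw [extensionπ_comp, Category.assoc]
  map_id X := extension_hom_ext fun G φ => by
    rw [extensionLift_π, Category.id_comp, Category.id_comp]
  map_comp m n := extension_hom_ext fun G φ => by
    rw [extensionLift_π, Category.assoc, Category.assoc, extensionLift_π, extensionLift_π]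

theorem extension_map_π (T : M ⥤ C) {X Y : N} (m : X ⟶ Y) {G : M} (φ : Y ⟶ F.obj G) :
    (extension F T).map m ≫ extensionπ T φ = extensionπ T (m ≫ φ) :=
  extensionLift_π (fun G φ => extensionπ T (m ≫ φ)) (fun G G' φ g => by
    rw [extensionπ_comp, Category.assoc]) φ

/-- The functoriality of extension along `F`. -/
noncomputable def extensionMap {T T' : M ⥤ C} (α : T ⟶ T') : extension F T ⟶ extension F T' where
  app X := (limFunctor C (StructuredArrow X F)).map
    (Functor.whiskerLeft (StructuredArrow.proj X F) α)
  naturality X Y m := extension_hom_ext fun G φ => by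
    have h (X : N) (φ : X ⟶ F.obj G) : (limFunctor C (StructuredArrow X F)).map
        (Functor.whiskerLeft (StructuredArrow.proj X F) α) ≫ extensionπ T' φ =
          extensionπ T φ ≫ yoneda.map (α.app G) :=
      limFunctor_map_π _ (StructuredArrow.mk φ)
    rw [Category.assoc, h, ← Category.assoc, extension_map_π, Category.assoc, extension_map_π, h]

theorem extensionMap_app_π {T T' : M ⥤ C} (α : T ⟶ T') {X : N} {G : M} (φ : X ⟶ F.obj G) :
    (extensionMap F α).app X ≫ extensionπ T' φ = extensionπ T φ ≫ yoneda.map (α.app G) :=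
  limFunctor_map_π _ (StructuredArrow.mk φ)

theorem isIso_extensionMap_app {T T' : M ⥤ C} (α : T ⟶ T') [IsIso α] (X : N) :
    IsIso ((extensionMap F α).app X) :=
  have : IsIso (Functor.whiskerLeft (StructuredArrow.proj X F) α) := inferInstance
  Functor.map_isIso (limFunctor C (StructuredArrow X F)) _

/-- The extension along `F` of a functor to structures. -/
noncomputable def extensionStructure {B : Sketch} (E : M ⥤ B.Structure C) :
    N ⥤ B.Structure (ProCompletion C) where
  obj X :=
    -- The structures `E.obj j.right`, for `j` in the comma category, are regrouped as one diagram
    -- of functors per vertex. Evaluation of `G` at `j` gives back `E.obj j.right`, so every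
    -- condition holds levelwise and passes to the limit.
    let G : B.V ⥤q (StructuredArrow X F ⥤ C) :=
      { obj := fun b => StructuredArrow.proj X F ⋙ E ⋙ Sketch.Structure.eval C b
        map := fun f => Functor.whiskerLeft (StructuredArrow.proj X F)
          (Functor.whiskerLeft E (Sketch.Structure.evalMap C f)) }
    { graph := G ⋙q (limFunctor C (StructuredArrow X F)).toPrefunctor
      comm := fun c hc => CommCondition.Holds.comp_functor (G := G) (by
        ext j
        have h := (E.obj j.right).comm c hc
        have key {a b : B.V} (p : Quiver.Path a b) : (composePath (G.mapPath p)).app j =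
            composePath ((E.obj j.right).graph.mapPath p) :=
          (CommCondition.composePath_mapPath_comp_functor G ((evaluation _ C).obj j) p).symm
        exact (key c.left).trans (h.trans (key c.right).symm)) _
      lim := fun t ht => (t.holds_iff _).2 <|
        isGraphLimit_limFunctor (K := t.D ⋙q G) (c := fun h => G.map (t.leg h))
          fun j => (t.holds_iff _).1 ((E.obj j.right).lim t ht)
      colim := fun t ht => (t.holds_iff _).2 <|
        isGraphColimit_limFunctor (K := t.D ⋙q G) (c := fun h => G.map (t.leg h))
          fun j => (t.holds_iff _).1 ((E.obj j.right).colim t ht) }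
  map m :=
    { app := fun b => (extension F (E ⋙ Sketch.Structure.eval C b)).map m
      naturality := fun a b f =>
        ((extensionMap F (Functor.whiskerLeft E (Sketch.Structure.evalMap C f))).naturality
          m).symm }
  map_id X := Sketch.Structure.hom_ext fun b => (extension F _).map_id X
  map_comp m n := Sketch.Structure.hom_ext fun b => (extension F _).map_comp m n

end Extension

/-! ### Functors to the pro-completion as cofiltered limits of functors to the base -/

section Density

variable [HasFiniteLimits C] {A : Type} [SmallCategory A]

variable (C A) in
/-- The functor of composition with the Yoneda embedding. -/
abbrev compYoneda : (A ⥤ C) ⥤ (A ⥤ ProCompletion C) :=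
  (Functor.whiskeringRight A C (ProCompletion C)).obj yoneda

/-- Finite limits of functors are pointwise. This is what makes the category of base-valued functors
under a given `X` cofiltered. -/
instance : PreservesFiniteLimits (compYoneda C A) where
  preservesFiniteLimits _ _ _ := inferInstance

/-- The universal property of a cofree functor on an object, that is, of a right Kan extension along
the inclusion of an object. -/
theorem existsUnique_hom_of_isLimit {A : Type*} [Category* A] {D : Type*} [Category* D] {R : A ⥤ D}
    {a : A} {c : D} (ε : R.obj a ⟶ c)
    (hR : ∀ b, Nonempty (IsLimit (Fan.mk (R.obj b) fun f : b ⟶ a => R.map f ≫ ε)))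
    {X : A ⥤ D} (x : X.obj a ⟶ c) : ∃! φ : X ⟶ R, φ.app a ≫ ε = x := by
  -- The component at `b` is forced: naturality along `f : b ⟶ a` prescribes its `f`-th coordinate.
  have hl (b : A) : ∃ l : X.obj b ⟶ R.obj b, ∀ f : b ⟶ a, l ≫ R.map f ≫ ε = X.map f ≫ x :=
    ⟨Fan.IsLimit.lift (hR b).some fun f => X.map f ≫ x,
      Fan.IsLimit.fac (hR b).some fun f => X.map f ≫ x⟩
  have ext {b : A} {S : D} {m n : S ⟶ R.obj b}
      (h : ∀ f : b ⟶ a, m ≫ R.map f ≫ ε = n ≫ R.map f ≫ ε) : m = n :=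
    Fan.IsLimit.hom_ext (hR b).some _ _ h
  choose l hl using hl
  refine ⟨{ app := l, naturality := fun b b' g => ext fun f => ?_ }, ?_, fun φ hφ => ?_⟩
  · rw [Category.assoc, hl, Category.assoc, ← R.map_comp_assoc, hl, X.map_comp, Category.assoc]
  · simpa using hl a (𝟙 a)
  · ext b
    refine ext fun f => ?_
    rw [hl, ← hφ, φ.naturality_assoc]

/-- The comparison of a functor to the pro-completion with the pointwise cofiltered limit of the
functors to the base category under it. -/
noncomputable def toExtension (X : A ⥤ ProCompletion C) (a : A) :
    X.obj a ⟶ (extension (compYoneda C A) ((evaluation A C).obj a)).obj X :=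
  extensionLift (F := compYoneda C A) (fun _ φ => φ.app a) fun _ _ _ _ => rfl

theorem toExtension_π {X : A ⥤ ProCompletion C} {G : A ⥤ C} (φ : X ⟶ (compYoneda C A).obj G)
    (a : A) : toExtension X a ≫ extensionπ ((evaluation A C).obj a) φ = φ.app a :=
  extensionLift_π (F := compYoneda C A) (T := (evaluation A C).obj a) (fun _ φ => φ.app a)
    (fun _ _ _ _ => rfl) φ

variable [∀ a b : A, Finite (a ⟶ b)]

-- The cofree functor on `c` at `a` takes `b` to the power of `c` by the set of arrows `b ⟶ a`. That
-- set is finite, so finite limits in `C` suffice; `ε` is the coordinate at the identity.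
variable (C A) in
theorem exists_power (a : A) (c : C) : ∃ (R : A ⥤ C) (ε : R.obj a ⟶ c),
    ∀ b, Nonempty (IsLimit (Fan.mk (R.obj b) fun f : b ⟶ a => R.map f ≫ ε)) := by
  let R := (evaluationRightAdjoint C a).obj c
  let ε : R.obj a ⟶ c := Pi.π (fun _ : a ⟶ a => c) (𝟙 a)
  refine ⟨R, ε, fun b => ⟨?_⟩⟩
  have h : (fun f : b ⟶ a => R.map f ≫ ε) = fun f => Pi.π (fun _ : b ⟶ a => c) f := by
    funext f
    refine (Pi.lift_π _ _).trans ?_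
    rw [Category.comp_id]
  rw [h]
  exact productIsProduct _

/-- Every functor from a category with finite hom sets to the pro-completion is the pointwise
cofiltered limit of the functors to the base category under it. -/
theorem isIso_toExtension (X : A ⥤ ProCompletion C) (a : A) : IsIso (toExtension X a) := by
  refine isIso_of_bijective _ fun c => ?_
  obtain ⟨R, ε, hR⟩ := exists_power C A a c
  -- `yoneda` preserves these finite powers, so `R ⋙ yoneda` is cofree on `yoneda.obj c`: maps
  -- `X.obj a ⟶ yoneda.obj c` correspond to maps `X ⟶ R ⋙ yoneda`, which are themselves indices of
  -- the limit.
  have hR' (b : A) : Nonempty (IsLimit (Fan.mk ((R ⋙ yoneda).obj b)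
      fun f : b ⟶ a => (R ⋙ yoneda).map f ≫ yoneda.map ε)) := by
    have := Fintype.ofFinite (b ⟶ a)
    have h : (fun f : b ⟶ a => (R ⋙ yoneda).map f ≫ yoneda.map ε) =
        fun f : b ⟶ a => yoneda.map (R.map f ≫ ε) := by
      funext f
      exact (yoneda.map_comp _ _).symm
    rw [h]
    exact ⟨isLimitFanMkObjOfIsLimit yoneda _ _ (hR b).some⟩
  have hφ (x : X.obj a ⟶ yoneda.obj c) :=
    existsUnique_hom_of_isLimit (R := R ⋙ yoneda) (yoneda.map ε) hR' x
  -- A map `w` out of the limit is determined by its composite with `toExtension X a`. It factors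
  -- through some index `j` by a map `u`, and cofreeness of `R` in the base turns `u` into an arrow
  -- `v` of functors. Composing `j.hom` with `v` gives the index `φ` attached to the composite, by
  -- uniqueness.
  have hw (w : lim (StructuredArrow.proj X (compYoneda C A) ⋙ (evaluation A C).obj a) ⟶
      yoneda.obj c) (φ : X ⟶ (compYoneda C A).obj R)
      (h : φ.app a ≫ yoneda.map ε = toExtension X a ≫ w) :
      w = extensionπ ((evaluation A C).obj a) φ ≫ yoneda.map ε := by
    obtain ⟨θ, hθ, hθπ⟩ := lim.exists_bijective
      (StructuredArrow.proj X (compYoneda C A) ⋙ (evaluation A C).obj a) c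
    obtain ⟨y, rfl⟩ := hθ.surjective w
    obtain ⟨⟨j⟩, u, rfl⟩ := Types.jointly_surjective _ (colimit.isColimit _) y
    change j.right.obj a ⟶ c at u
    have hu : θ (colimit.ι ((StructuredArrow.proj X (compYoneda C A) ⋙
        (evaluation A C).obj a).op ⋙ CategoryTheory.yoneda.obj c) (op j) u) =
          extensionπ ((evaluation A C).obj a) j.hom ≫ yoneda.map u := hθπ j u
    obtain ⟨v, hv, -⟩ := existsUnique_hom_of_isLimit ε hR u
    refine hu.trans ?_
    have hjv : j.hom ≫ (compYoneda C A).map v = φ := by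
      refine (hφ _).unique ?_ h
      refine Eq.trans ?_ (congrArg (toExtension X a ≫ ·) hu.symm)
      refine Eq.trans ?_ (Category.assoc _ _ _)
      rw [toExtension_π, ← hv, Functor.map_comp, ← Category.assoc]
      rfl
    rw [← hjv, ← extensionπ_comp, Category.assoc, ← hv, Functor.map_comp]
    rfl
  constructor
  · intro w w' h
    obtain ⟨φ, hφ, -⟩ := hφ (toExtension X a ≫ w)
    rw [hw w φ hφ, hw w' φ (hφ.trans h)]
  · intro x
    obtain ⟨φ, hφ, -⟩ := hφ x
    refine ⟨extensionπ ((evaluation A C).obj a) φ ≫ yoneda.map ε, ?_⟩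
    refine (Category.assoc _ _ _).symm.trans ?_
    rw [toExtension_π]
    exact hφ

end Density

end ProCompletion

/-! ### The extended verification and its strictification -/

namespace ProCompletion

variable {C : Type u} [SmallCategory C] [HasFiniteLimits C]

/-- A right inverse up to isomorphism of restriction along `β`, defined on functors from a finite
category to the base category, extends to functors to the pro-completion. -/
noncomputable def extensionStructureCompRestrictIso {A B : Sketch} (β : Sketch.Hom A B)
    (K : Sketch.CategoryOn A.V) (hc : A.comm = K.comms) (hl : A.lim = ∅) (hr : A.colim = ∅)
    [∀ a b : K.Carrier, Finite (a ⟶ b)] (E : (K.Carrier ⥤ C) ⥤ B.Structure C)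
    (e : K.toStructure C hc hl hr ≅ E ⋙ β.restrict C) :
    K.toStructure (ProCompletion C) hc hl hr ≅
      extensionStructure (compYoneda C K.Carrier) E ⋙ β.restrict (ProCompletion C) := by
  let F := compYoneda C K.Carrier
  -- At a vertex `a` of `A`, the base verification returns the value of the functor at `a`, up to
  -- the isomorphism `e`.
  let η (a : K.Carrier) : (evaluation K.Carrier C).obj a ≅
      E ⋙ Sketch.Structure.eval C (β.graph.obj a) :=
    Functor.isoWhiskerRight e (Sketch.Structure.eval C (S := A) a)
  have hη {a b : K.Carrier} (f : a ⟶ b) : (η a).hom ≫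
      Functor.whiskerLeft E (Sketch.Structure.evalMap C (β.graph.map f)) =
        (evaluation K.Carrier C).map f ≫ (η b).hom := by
    ext G
    exact (Sketch.Structure.Hom.naturality (e.hom.app G) (a := a) (b := b) f).symm
  -- Density presents `X.obj a` as the limit of the values `G.obj a`, and `η` then identifies the
  -- terms of that diagram with those defining the extended structure. All naturality is checked on
  -- the projections, using `hγ`.
  let γ (X : K.Carrier ⥤ ProCompletion C) (a : K.Carrier) :
      X.obj a ⟶ (extension F (E ⋙ Sketch.Structure.eval C (β.graph.obj a))).obj X :=
    toExtension X a ≫ (extensionMap F (η a).hom).app X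
  have hγ (X : K.Carrier ⥤ ProCompletion C) (a : K.Carrier) {G : K.Carrier ⥤ C}
      (φ : X ⟶ F.obj G) : γ X a ≫ extensionπ _ φ = φ.app a ≫ yoneda.map ((η a).hom.app G) := by
    rw [Category.assoc, extensionMap_app_π, ← Category.assoc, toExtension_π]
  have hγ' (X : K.Carrier ⥤ ProCompletion C) (a : K.Carrier) : IsIso (γ X a) :=
    have := isIso_toExtension X a
    have := isIso_extensionMap_app F (η a).hom X
    IsIso.comp_isIso
  have hγ_map (X : K.Carrier ⥤ ProCompletion C) {a b : K.Carrier} (f : a ⟶ b) :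
      X.map f ≫ γ X b = γ X a ≫ (extensionMap F
        (Functor.whiskerLeft E (Sketch.Structure.evalMap C (β.graph.map f)))).app X := by
    clear_value γ
    refine extension_hom_ext fun G φ => ?_
    rw [Category.assoc, Category.assoc, hγ, extensionMap_app_π, ← Category.assoc (γ X a), hγ,
      Category.assoc, ← Functor.map_comp, ← NatTrans.comp_app, hη, ← Category.assoc,
      φ.naturality, Category.assoc, NatTrans.comp_app, Functor.map_comp]
    rfl
  have hγ_app {X Y : K.Carrier ⥤ ProCompletion C} (m : X ⟶ Y) (a : K.Carrier) :
      m.app a ≫ γ Y a = γ X a ≫ (extension F _).map m := by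
    clear_value γ
    refine extension_hom_ext fun G φ => ?_
    rw [Category.assoc, Category.assoc, hγ, extension_map_π, hγ, NatTrans.comp_app, Category.assoc]
  exact NatIso.ofComponents (fun X => Sketch.Structure.isoMk
    (fun a => @asIso _ _ _ _ (γ X a) (hγ' X a)) fun a b f => hγ_map X f)
    fun m => Sketch.Structure.hom_ext fun a => hγ_app m a

end ProCompletion

/-- Let `∅ ⟶ A ⟶ B` be an exactness sequent of type the empty sketch whose first inclusion is
unconditional of finite kind, and let `C` be a small finitely complete category. If the sequent
admits a functorial verification for `C`, then it admits one for the pro-completion of `C`. -/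
theorem corollary2p3 (s : Sketch.Sequent Sketch.empty)
    (hs : s.α.IsUnconditionalOfFiniteKind)
    (C : Type u) [SmallCategory C] [HasFiniteLimits C]
    (h : s.HoldsFunctorially C) : s.HoldsFunctorially (ProCompletion C) := by
  -- The conditions inherited from the empty sketch form empty sets, which leaves only those coming
  -- from the category structure `K`.
  obtain ⟨-, K, hc, hl, hr⟩ := hs
  replace hc : s.A.comm = K.comms := by
    rw [hc, Set.union_eq_left]
    rintro c ⟨x, hx, -⟩
    exact hx.elim
  replace hl : s.A.lim = ∅ := by
    rw [hl, Set.eq_empty_iff_forall_notMem]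
    rintro c ⟨x, hx, -⟩
    exact hx.elim
  replace hr : s.A.colim = ∅ := by
    rw [hr, Set.eq_empty_iff_forall_notMem]
    rintro c ⟨x, hx, -⟩
    exact hx.elim
  obtain ⟨E, hE⟩ := s.holdsFunctorially_iff.1 h
  have : ∀ a b : K.Carrier, Finite (a ⟶ b) := s.A.finite_hom
  let e := ProCompletion.extensionStructureCompRestrictIso s.β K hc hl hr
    (K.toStructure C hc hl hr ⋙ E) (eqToIso (congrArg (K.toStructure C hc hl hr ⋙ ·) hE).symm)
  refine s.holdsFunctorially_iff.2 (Sketch.exists_comp_restrict_eq_id s.isInclusion_β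
    (K.ofStructure (ProCompletion C) hc ⋙
      ProCompletion.extensionStructure (ProCompletion.compYoneda C K.Carrier)
        (K.toStructure C hc hl hr ⋙ E)) ?_)
  -- Passing from structures to functors and back is the identity by definition, so the whiskered
  -- isomorphism ends at the identity functor.
  exact Functor.isoWhiskerLeft (K.ofStructure (ProCompletion C) hc) e.symm
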